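/- For real $z$ let $P(z)=\prod_{p\le z}p$ be the product of all primes up to $z$. Fix an integer $s\ge 0$. Call a positive integer $Q$ a \emph{dutiful modulus} (with respect to $s$) if for every positive integer $q\le(\log Q)^{1/10}$ and every Dirichlet character $\chi$ modulo $(qQ)^{\lfloor 20s\log\log Q\rfloor}$, every $\beta\in[1/2,1]$ with $L(\beta,\chi)=0$ satisfies $$\beta\le 1-\frac{1}{(\log Q)^2}.$$ (For principal $\chi$ the point $\beta=1$ is a pole of $L(\cdot,\chi)$, not a zero.) Proposition. For every integer $s\ge 0$ there are arbitrarily large $z$ such that $P(z)$ is a dutiful modulus with respect to $s$. -/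

import Mathlib

/-- The primorial `P(z) = ∏_{p ≤ z} p`, the product of all primes up to the real number `z`. -/
noncomputable def primeProduct (z : ℝ) : ℕ :=
  ∏ p ∈ Finset.Icc 1 ⌊z⌋₊ with p.Prime, p

theorem primeProduct_ne_zero (z : ℝ) : primeProduct z ≠ 0 :=
  Finset.prod_ne_zero_iff.mpr fun _ hp => (Finset.mem_filter.mp hp).2.ne_zero

instance primeProduct_neZero (z : ℝ) : NeZero (primeProduct z) :=
  ⟨primeProduct_ne_zero z⟩

/-- A modulus `Q ≥ 1` is dutiful (with respect to the integer `s ≥ 0`) if for every positive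
integer `q ≤ (log Q)^(1/10)` and every Dirichlet character `χ` modulo
`(q Q)^⌊20 s log log Q⌋`, every zero `β ∈ [1/2, 1]` of `L(·, χ)` satisfies
`β ≤ 1 - 1 / (log Q)^2`.
The clause `χ ≠ 1 ∨ β ≠ 1` only discards the value that Mathlib assigns to the `L`-function of
the principal character at its pole. -/
def IsDutiful (s Q : ℕ) [NeZero Q] : Prop :=
  ∀ (q : ℕ) [NeZero q], (q : ℝ) ≤ Real.log (Q : ℝ) ^ (1 / 10 : ℝ) →
    ∀ χ : DirichletCharacter ℂ ((q * Q) ^ ⌊20 * (s : ℝ) * Real.log (Real.log (Q : ℝ))⌋₊),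
      ∀ β ∈ Set.Icc (1 / 2 : ℝ) 1, (χ ≠ 1 ∨ β ≠ 1) →
        DirichletCharacter.LFunction χ (β : ℂ) = 0 →
          β ≤ 1 - 1 / Real.log (Q : ℝ) ^ 2

/-! A modulus that is large and not dutiful yields a real zero extremely close to 1, and Landau's
repulsion of exceptional zeros forbids this at every scale. Write `ℓ n` for the logarithm of the
primorial of `n`. If all large primorials fail, each large `n` gives a nontrivial character of some
modulus `N`, with `log N` at most of order `ℓ n * log (ℓ n)`, and a zero within `1 / ℓ n ^ 2` of 1
(`exists_zero_of_not_isDutiful`). Fix one such zero `β₁ < 1`, and let `m + 1` be the first later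
index with `1 / ℓ (m + 1) ^ 2 ≤ 1 - β₁`. The zero `β₂` found there exceeds `β₁`, yet `1 - β₁ < 1 / ℓ
m ^ 2 ≤ 4 / ℓ (m + 1) ^ 2`, because consecutive scales differ by a factor of at most 2. Lifting both
characters to the product modulus, Landau's theorem (`exists_le_one_sub_div_log_of_lt`) forces `1 -
β₁` to be at least of order `1 / (ℓ (m + 1) * log (ℓ (m + 1)))`, which is absurd for large `ℓ`.
Landau's theorem itself plays the pole of zeta against the zeros, via positivity of von Mangoldt
sums and lower bounds for `Re L'/L` just right of 1. -/

/-! ### Lower bounds for the logarithmic derivative of an entire function. -/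

-- Being zero-free, `g / g 0` has a holomorphic logarithm `h` with `h 0 = 0` and real part at most
-- `M`. Borel–Carathéodory gives `‖h‖ ≤ 2 * M` at radius `r / 2`, and Cauchy's estimate there gives
-- the constant 4.
open Complex Metric Set in
theorem norm_logDeriv_zero_le_of_norm_le {g : ℂ → ℂ} {r M : ℝ} (hr : 0 < r) (hM : 0 < M)
    (hg : DifferentiableOn ℂ g (ball 0 r)) (h0 : ∀ z ∈ ball (0 : ℂ) r, g z ≠ 0)
    (hb : ∀ z ∈ ball (0 : ℂ) r, ‖g z‖ ≤ ‖g 0‖ * Real.exp M) :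
    ‖logDeriv g 0‖ ≤ 4 * M / r := by
  have hmem : (0 : ℂ) ∈ ball (0 : ℂ) r := mem_ball_self hr
  have hd : DifferentiableOn ℂ (logDeriv g) (ball 0 r) := (hg.deriv isOpen_ball).div hg h0
  obtain ⟨h, hh0, hh⟩ := hd.isExactOn_ball.with_val_at 0 0
  have hgd : ∀ z ∈ ball (0 : ℂ) r, HasDerivAt g (deriv g z) z := fun z hz ↦
    (hg.differentiableAt (isOpen_ball.mem_nhds hz)).hasDerivAt
  have hconst : ∀ z ∈ ball (0 : ℂ) r, g z * exp (-h z) = g 0 := by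
    have hder : ∀ z ∈ ball (0 : ℂ) r, HasDerivAt (fun w ↦ g w * exp (-h w)) 0 z := by
      intro z hz
      refine ((hgd z hz).mul (hh z hz).neg.cexp).congr_deriv ?_
      have := h0 z hz
      simp only [logDeriv_apply]
      field_simp
      simp
    intro z hz
    have := isOpen_ball.is_const_of_deriv_eq_zero (convex_ball (0 : ℂ) r).isPreconnected
      (fun z hz ↦ (hder z hz).differentiableAt.differentiableWithinAt)
      (fun z hz ↦ (hder z hz).deriv) hz hmem
    simpa [hh0] using this
  have hre : MapsTo h (ball 0 r) {z | z.re ≤ M} := by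
    intro z hz
    have h1 : g z = g 0 * exp (h z) := by
      rw [← hconst z hz, mul_assoc, ← exp_add]; simp
    have h2 := hb z hz
    rw [h1, norm_mul, norm_exp] at h2
    exact Real.exp_le_exp.mp (le_of_mul_le_mul_left h2 (norm_pos_iff.mpr (h0 0 hmem)))
  have hhd : DifferentiableOn ℂ h (ball 0 r) := fun z hz ↦
    (hh z hz).differentiableAt.differentiableWithinAt
  have hsub : closedBall (0 : ℂ) (r / 2) ⊆ ball 0 r := closedBall_subset_ball (by linarith)
  have hC : ∀ z ∈ sphere (0 : ℂ) (r / 2), ‖h z‖ ≤ 2 * M := by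
    intro z hz
    have := borelCaratheodory_zero hM hhd hre hr (hsub (sphere_subset_closedBall hz)) hh0
    rw [mem_sphere_zero_iff_norm.mp hz] at this
    refine this.trans (le_of_eq ?_)
    field_simp
    norm_num
  have := norm_deriv_le_of_forall_mem_sphere_norm_le (by positivity)
    (hhd.diffContOnCl_ball hsub) hC
  rw [(hh 0 hmem).deriv] at this
  refine this.trans (le_of_eq ?_)
  field_simp
  norm_num

-- On the circle of radius `R` the factor `1 - z / ρ` has modulus at least 2, so by the maximum
-- principle dividing it out gains `log 2` in the exponent.
open Complex Metric Set in
theorem exists_eq_one_sub_div_mul {f : ℂ → ℂ} {ρ : ℂ} {R M : ℝ} (hf : Differentiable ℂ f)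
    (hf0 : f 0 ≠ 0) (hρ : f ρ = 0) (hρR : ‖ρ‖ ≤ R / 3)
    (hb : ∀ z ∈ closedBall (0 : ℂ) R, ‖f z‖ ≤ ‖f 0‖ * Real.exp M) :
    ∃ g : ℂ → ℂ, Differentiable ℂ g ∧ (∀ z, f z = (1 - z / ρ) * g z) ∧ g 0 = f 0 ∧
      logDeriv f 0 = logDeriv g 0 - 1 / ρ ∧
      ∀ z ∈ closedBall (0 : ℂ) R, ‖g z‖ ≤ ‖g 0‖ * Real.exp (M - Real.log 2) := by
  have hρ0 : ρ ≠ 0 := by rintro rfl; exact hf0 hρ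
  have hpos : 0 < ‖ρ‖ := norm_pos_iff.mpr hρ0
  have hR : 0 < R := by linarith
  set g : ℂ → ℂ := fun z ↦ -ρ * dslope f ρ z with hg
  have hgd : Differentiable ℂ g := by
    have : DifferentiableOn ℂ (dslope f ρ) univ :=
      (differentiableOn_dslope Filter.univ_mem).mpr hf.differentiableOn
    exact (differentiableOn_univ.mp this).const_mul _
  have hfg : ∀ z, f z = (1 - z / ρ) * g z := by
    intro z
    have h1 := sub_smul_dslope f ρ z
    rw [hρ, sub_zero, smul_eq_mul] at h1
    rw [← h1, hg]
    field_simp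
    ring
  have hg0 : g 0 = f 0 := by rw [hfg 0]; simp
  refine ⟨g, hgd, hfg, hg0, ?_, ?_⟩
  · have h1 : HasDerivAt (fun z : ℂ ↦ 1 - z / ρ) (-(1 / ρ)) 0 :=
      ((hasDerivAt_id (0 : ℂ)).div_const ρ).const_sub 1
    have h2 := h1.mul (hgd 0).hasDerivAt
    have h3 : deriv f 0 = -(1 / ρ) * g 0 + deriv g 0 := by
      have : f = fun z ↦ (1 - z / ρ) * g z := funext hfg
      rw [this]
      exact h2.deriv.trans (by simp)
    rw [logDeriv_apply, logDeriv_apply, h3, ← hg0]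
    have : g 0 ≠ 0 := hg0 ▸ hf0
    field_simp
    ring
  · intro z hz
    refine norm_le_of_forall_mem_frontier_norm_le (U := ball (0 : ℂ) R) isBounded_ball
      (hgd.diffContOnCl) ?_ ?_
    · intro w hw
      rw [frontier_ball _ hR.ne', mem_sphere_zero_iff_norm] at hw
      have h1 := hb w (mem_closedBall_zero_iff.mpr hw.le)
      rw [hfg w, norm_mul] at h1
      have h2 : (2 : ℝ) ≤ ‖1 - w / ρ‖ := by
        have : (3 : ℝ) ≤ ‖w / ρ‖ := by
          rw [norm_div, hw, le_div_iff₀ hpos]; linarith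
        have h3 := norm_sub_norm_le (w / ρ) 1
        rw [norm_one, norm_sub_rev] at h3
        linarith
      rw [Real.exp_sub, Real.exp_log two_pos, hg0, ← mul_div_assoc, le_div_iff₀ two_pos, mul_comm]
      exact (mul_le_mul_of_nonneg_right h2 (norm_nonneg _)).trans h1
    · rwa [closure_ball _ hR.ne']

-- Zeros in the inner third are divided out one at a time. Each contributes `Re (-1 / ρ) ≥ 0`, which
-- is dropped, and lowers `M` by `log 2`, so the process stops. The remaining function is zero-free
-- on the disc of radius `R / 3`.
open Complex Metric Set in
theorem neg_le_re_logDeriv_zero {R : ℝ} (hR : 0 < R) {f : ℂ → ℂ} {M : ℝ}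
    (hf : Differentiable ℂ f) (hf0 : f 0 ≠ 0)
    (hb : ∀ z ∈ closedBall (0 : ℂ) R, ‖f z‖ ≤ ‖f 0‖ * Real.exp M)
    (hz : ∀ ρ : ℂ, f ρ = 0 → ρ.re ≤ 0) :
    -(12 * (M + 1) / R) ≤ (logDeriv f 0).re := by
  obtain ⟨n, hn⟩ := exists_nat_gt (M / Real.log 2)
  rw [div_lt_iff₀ (Real.log_pos one_lt_two)] at hn
  induction n generalizing f M with
  | zero =>
    have h1 := hb 0 (mem_closedBall_self hR.le)
    have h2 : 1 ≤ Real.exp M := by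
      by_contra! h
      nlinarith [norm_pos_iff.mpr hf0]
    have := Real.one_le_exp_iff.mp h2
    simp at hn
    linarith
  | succ n ih =>
    by_cases hex : ∃ ρ, f ρ = 0 ∧ ‖ρ‖ ≤ R / 3
    · obtain ⟨ρ, hρ, hρR⟩ := hex
      obtain ⟨g, hgd, hfg, hg0, hlog, hgb⟩ := exists_eq_one_sub_div_mul hf hf0 hρ hρR hb
      have h1 := ih hgd (hg0 ▸ hf0) hgb (fun w hw ↦ hz w (by rw [hfg, hw, mul_zero]))
        (by push_cast at hn; linarith)
      rw [hlog, sub_re]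
      have h2 : (1 / ρ).re ≤ 0 := by
        rw [one_div, inv_re]
        exact div_nonpos_of_nonpos_of_nonneg (hz ρ hρ) (normSq_nonneg _)
      have h3 : 12 * (M - Real.log 2 + 1) / R ≤ 12 * (M + 1) / R := by
        gcongr
        linarith [Real.log_pos one_lt_two]
      linarith
    · push Not at hex
      have hM : 0 ≤ M := by
        have h1 := hb 0 (mem_closedBall_self hR.le)
        have h2 : 1 ≤ Real.exp M := by
          by_contra! h
          nlinarith [norm_pos_iff.mpr hf0]
        exact Real.one_le_exp_iff.mp h2
      -- `M + 1` replaces `M` because strict positivity is needed; the constant is `12 = 4 * 3`.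
      have h1 := norm_logDeriv_zero_le_of_norm_le (g := f) (r := R / 3) (M := M + 1)
        (by positivity) (by positivity) hf.differentiableOn
        (fun z hz h ↦ by
          have := hex z h
          rw [mem_ball_zero_iff] at hz
          linarith)
        (fun z hz ↦ (hb z (by
          rw [mem_ball_zero_iff] at hz
          rw [mem_closedBall_zero_iff]
          linarith)).trans (by gcongr; linarith))
      have h2 := neg_le_of_abs_le ((abs_re_le_norm _).trans h1)
      refine le_trans (le_of_eq ?_) h2
      field_simp
      norm_num

open Complex Metric Set in
theorem inv_sub_le_re_logDeriv_zero {R : ℝ} (hR : 0 < R) {f : ℂ → ℂ} {M : ℝ} {ρ : ℂ}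
    (hf : Differentiable ℂ f) (hf0 : f 0 ≠ 0)
    (hb : ∀ z ∈ closedBall (0 : ℂ) R, ‖f z‖ ≤ ‖f 0‖ * Real.exp M)
    (hz : ∀ ρ : ℂ, f ρ = 0 → ρ.re ≤ 0) (hρ : f ρ = 0) (hρR : ‖ρ‖ ≤ R / 3) :
    (-(1 / ρ)).re - 12 * (M + 1) / R ≤ (logDeriv f 0).re := by
  obtain ⟨g, hgd, hfg, hg0, hlog, hgb⟩ := exists_eq_one_sub_div_mul hf hf0 hρ hρR hb
  have h1 := neg_le_re_logDeriv_zero hR hgd (hg0 ▸ hf0) hgb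
    (fun w hw ↦ hz w (by rw [hfg, hw, mul_zero]))
  rw [hlog, sub_re, neg_re]
  have h3 : 12 * (M - Real.log 2 + 1) / R ≤ 12 * (M + 1) / R := by
    gcongr
    linarith [Real.log_pos one_lt_two]
  linarith

open Complex Metric Set in
theorem inv_add_inv_sub_le_re_logDeriv_zero {R : ℝ} (hR : 0 < R) {f : ℂ → ℂ} {M : ℝ} {ρ ρ' : ℂ}
    (hf : Differentiable ℂ f) (hf0 : f 0 ≠ 0)
    (hb : ∀ z ∈ closedBall (0 : ℂ) R, ‖f z‖ ≤ ‖f 0‖ * Real.exp M)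
    (hz : ∀ ρ : ℂ, f ρ = 0 → ρ.re ≤ 0) (hρ : f ρ = 0) (hρR : ‖ρ‖ ≤ R / 3)
    (hρ' : f ρ' = 0) (hρR' : ‖ρ'‖ ≤ R / 3) (hne : ρ' ≠ ρ) :
    (-(1 / ρ)).re + (-(1 / ρ')).re - 12 * (M + 1) / R ≤ (logDeriv f 0).re := by
  obtain ⟨g, hgd, hfg, hg0, hlog, hgb⟩ := exists_eq_one_sub_div_mul hf hf0 hρ hρR hb
  have hρ0 : ρ ≠ 0 := by rintro rfl; exact hf0 hρ
  have hgρ' : g ρ' = 0 := by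
    have := hfg ρ'
    rw [hρ', eq_comm, mul_eq_zero] at this
    refine this.resolve_left fun h ↦ hne ?_
    rw [sub_eq_zero, eq_comm, div_eq_one_iff_eq hρ0] at h
    exact h
  have h1 := inv_sub_le_re_logDeriv_zero hR hgd (hg0 ▸ hf0) hgb
    (fun w hw ↦ hz w (by rw [hfg, hw, mul_zero])) hgρ' hρR'
  rw [hlog, sub_re, neg_re]
  have h3 : 12 * (M - Real.log 2 + 1) / R ≤ 12 * (M + 1) / R := by
    gcongr
    linarith [Real.log_pos one_lt_two]
  linarith

/-! ### Size of Dirichlet L-functions and of zeta near 1. -/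

theorem DirichletCharacter.norm_sum_range_le {N : ℕ} [NeZero N] {χ : DirichletCharacter ℂ N}
    (hχ : χ ≠ 1) (m : ℕ) : ‖∑ k ∈ Finset.range m, χ k‖ ≤ N := by
  have hper : ∑ k ∈ Finset.range N, χ k = 0 := by
    rw [← MulChar.sum_eq_zero_of_ne_one hχ]
    obtain ⟨n, rfl⟩ := Nat.exists_eq_succ_of_ne_zero (NeZero.ne N)
    rw [← Fin.sum_univ_eq_sum_range (fun k ↦ χ (k : ZMod (n + 1)))]
    exact Finset.sum_congr rfl fun i _ ↦ by congr 1; exact Fin.cast_val_eq_self i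
  have hmul : ∀ q : ℕ, ∑ k ∈ Finset.range (N * q), χ k = 0 := by
    intro q
    induction q with
    | zero => simp
    | succ q ih => rw [mul_add, mul_one, Finset.sum_range_add, ih, zero_add, ← hper]; simp
  rw [← Nat.div_add_mod m N, Finset.sum_range_add, hmul, zero_add]
  refine (norm_sum_le_of_le _ fun k _ ↦ χ.norm_le_one _).trans ?_
  simpa using (Nat.mod_lt m (NeZero.pos N)).le

theorem DirichletCharacter.norm_sum_Icc_le {N : ℕ} [NeZero N] {χ : DirichletCharacter ℂ N}
    (hχ : χ ≠ 1) (m : ℕ) : ‖∑ k ∈ Finset.Icc 1 m, χ k‖ ≤ 2 * N := by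
  have h : ∑ k ∈ Finset.Icc 1 m, χ k = ∑ k ∈ Finset.range (m + 1), χ k - χ (0 : ℕ) := by
    rw [Finset.range_eq_Ico, Finset.sum_eq_sum_Ico_succ_bot (Nat.succ_pos m)]
    simp [Finset.Ico_add_one_right_eq_Icc]
  rw [h]
  have h1 := (norm_sub_le _ _).trans (add_le_add (norm_sum_range_le hχ (m + 1))
    (χ.norm_le_one ((0 : ℕ) : ZMod N)))
  have h2 : (1 : ℝ) ≤ N := by exact_mod_cast NeZero.pos N
  linarith

-- Partial summation writes `L(s, χ)` as `s` times the integral of the bounded character sum against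
-- `t ^ (-s - 1)`. This integral is a Mellin transform, hence analytic for `Re s > 0`, and the
-- identity theorem extends the formula from `Re s > 1`.
open Complex Set MeasureTheory Filter Asymptotics in
theorem DirichletCharacter.norm_LFunction_le {N : ℕ} [NeZero N] {χ : DirichletCharacter ℂ N}
    (hχ : χ ≠ 1) {s : ℂ} (hs : 0 < s.re) : ‖LFunction χ s‖ ≤ 2 * N * ‖s‖ / s.re := by
  set A : ℝ → ℂ := (Ioi (1 : ℝ)).indicator fun t ↦ ∑ k ∈ Finset.Icc 1 ⌊t⌋₊, χ k with hA
  have hAb : ∀ t, ‖A t‖ ≤ 2 * N := fun t ↦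
    (norm_indicator_le_norm_self _ t).trans (norm_sum_Icc_le hχ _)
  have hAm : Measurable A := by
    refine Measurable.indicator ?_ measurableSet_Ioi
    exact (measurable_from_nat (f := fun n : ℕ ↦ ∑ k ∈ Finset.Icc 1 n, χ k)).comp
      Nat.measurable_floor
  have hloc : LocallyIntegrableOn A (Ioi 0) := by
    refine LocallyIntegrable.locallyIntegrableOn ?_ _
    refine (locallyIntegrable_const (2 * N : ℝ)).mono hAm.aestronglyMeasurable
      (Eventually.of_forall fun t ↦ ?_)
    rw [Real.norm_of_nonneg (by positivity)]
    exact hAb t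
  have htop : A =O[atTop] (· ^ (-(0 : ℝ))) := by
    refine IsBigO.of_bound (2 * N) (Eventually.of_forall fun t ↦ ?_)
    simpa using hAb t
  have hbot : ∀ b : ℝ, A =O[nhdsWithin 0 (Ioi 0)] (· ^ (-b)) := fun b ↦ by
    refine IsBigO.of_bound 1 ?_
    have : Iio (1 : ℝ) ∈ nhdsWithin (0 : ℝ) (Ioi 0) :=
      mem_nhdsWithin_of_mem_nhds (Iio_mem_nhds one_pos)
    filter_upwards [this] with t ht
    rw [hA, indicator_of_notMem (by simpa using le_of_lt ht), norm_zero]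
    positivity
  have hdiff : ∀ z : ℂ, z.re < 0 → DifferentiableAt ℂ (mellin A) z := fun z hz ↦
    mellin_differentiableAt_of_isBigO_rpow hloc htop (by simpa using hz) (hbot (z.re - 1))
      (by linarith)
  have hmellin : ∀ z : ℂ, mellin A (-z) = ∫ t in Ioi (1 : ℝ),
      (∑ k ∈ Finset.Icc 1 ⌊t⌋₊, χ k) * (t : ℂ) ^ (-(z + 1)) := by
    intro z
    have : ∀ t : ℝ, (t : ℂ) ^ (-z - 1) • A t = (Ioi (1 : ℝ)).indicator
        (fun t : ℝ ↦ (∑ k ∈ Finset.Icc 1 ⌊t⌋₊, χ k) * (t : ℂ) ^ (-(z + 1))) t := by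
      intro t
      by_cases ht : t ∈ Ioi (1 : ℝ)
      · rw [hA, indicator_of_mem ht, indicator_of_mem ht, smul_eq_mul, mul_comm, neg_add']
      · rw [hA, indicator_of_notMem ht, indicator_of_notMem ht, smul_zero]
    rw [mellin, setIntegral_congr_fun measurableSet_Ioi fun t _ ↦ this t,
      setIntegral_indicator measurableSet_Ioi, inter_eq_right.mpr (Ioi_subset_Ioi zero_le_one)]
  have hU : IsOpen {z : ℂ | 0 < z.re} := isOpen_lt continuous_const continuous_re
  have heq : EqOn (LFunction χ) (fun z ↦ z * mellin A (-z)) {z : ℂ | 0 < z.re} := by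
    refine AnalyticOnNhd.eqOn_of_preconnected_of_eventuallyEq (𝕜 := ℂ) (z₀ := 2) ?_ ?_
      (convex_halfSpace_re_gt 0).isPreconnected (by simp) ?_
    · exact (differentiable_LFunction hχ).differentiableOn.analyticOnNhd hU
    · refine DifferentiableOn.analyticOnNhd (fun z hz ↦ ?_) hU
      have h1 : DifferentiableAt ℂ (mellin A) (-z) := hdiff _ (by simpa using hz)
      exact (differentiableAt_id.mul (h1.comp z differentiableAt_id.neg)).differentiableWithinAt
    · have h1 : {z : ℂ | 1 < z.re} ∈ nhds (2 : ℂ) :=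
        (isOpen_lt continuous_const continuous_re).mem_nhds (by simp)
      filter_upwards [h1] with z hz
      rw [LFunction_eq_LSeries χ hz, hmellin]
      refine LSeries_eq_mul_integral _ le_rfl (zero_lt_one.trans hz)
        (LSeriesSummable_of_one_lt_re χ hz) ?_
      refine IsBigO.of_bound (2 * N) (Eventually.of_forall fun n ↦ ?_)
      simpa using norm_sum_Icc_le hχ n
  rw [heq hs, norm_mul, hmellin]
  have hint : ‖∫ t in Ioi (1 : ℝ), (∑ k ∈ Finset.Icc 1 ⌊t⌋₊, χ k) * (t : ℂ) ^ (-(s + 1))‖ ≤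
      ∫ t in Ioi (1 : ℝ), 2 * N * t ^ (-s.re - 1) := by
    refine norm_integral_le_of_norm_le
      ((integrableOn_Ioi_rpow_of_lt (by linarith) one_pos).const_mul _) ?_
    refine (ae_restrict_mem measurableSet_Ioi).mono fun t ht ↦ ?_
    rw [norm_mul, norm_cpow_eq_rpow_re_of_pos (one_pos.trans ht)]
    have : (-(s + 1)).re = -s.re - 1 := by simp; ring
    rw [this]
    gcongr
    · exact Real.rpow_nonneg (one_pos.trans ht).le _
    · exact norm_sum_Icc_le hχ _
  rw [integral_const_mul, integral_Ioi_rpow_of_lt (by linarith) one_pos] at hint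
  calc _ ≤ ‖s‖ * _ := mul_le_mul_of_nonneg_left hint (norm_nonneg _)
    _ = _ := by
      simp only [sub_add_cancel, Real.one_rpow]
      field_simp

/-- The inverse of `L(σ, χ)` is the series of `μ χ`, which zeta dominates termwise. -/
theorem DirichletCharacter.one_le_norm_LFunction_mul {N : ℕ} [NeZero N]
    (χ : DirichletCharacter ℂ N) {σ : ℝ} (hσ : 1 < σ) :
    1 ≤ ‖LFunction χ σ‖ * ‖riemannZeta σ‖ := by
  have hσ' : 1 < (σ : ℂ).re := by simpa using hσ
  have h1 := LSeries.mul_mu_eq_one χ hσ'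
  have h2 : ‖LSeries ((fun n : ℕ ↦ χ n) * fun n ↦ ((ArithmeticFunction.moebius n : ℤ) : ℂ)) σ‖ ≤
      ‖riemannZeta σ‖ := by
    rw [← LSeries_one_eq_riemannZeta hσ']
    have hterm : ∀ n, LSeries.term 1 (σ : ℂ) n = ((if n = 0 then 0 else (n : ℝ) ^ (-σ) : ℝ) : ℂ) := by
      intro n
      rcases eq_or_ne n 0 with rfl | hn
      · simp
      · rw [LSeries.term_of_ne_zero hn, if_neg hn, Pi.one_apply, Complex.ofReal_cpow (by positivity)]
        push_cast
        rw [Complex.cpow_neg, one_div]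
    have hs := LSeriesSummable_one_iff.mpr hσ'
    have hnn : ∀ n : ℕ, (0 : ℝ) ≤ if n = 0 then 0 else (n : ℝ) ^ (-σ) := fun n ↦ by
      split_ifs <;> positivity
    have e1 : LSeries 1 (σ : ℂ) = ((∑' n : ℕ, (if n = 0 then 0 else (n : ℝ) ^ (-σ) : ℝ)) : ℝ) := by
      rw [LSeries, Complex.ofReal_tsum]
      exact tsum_congr hterm
    have hs' : Summable fun n : ℕ ↦ (if n = 0 then 0 else (n : ℝ) ^ (-σ) : ℝ) := by
      rw [LSeriesSummable, funext hterm] at hs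
      exact_mod_cast hs
    rw [e1, Complex.norm_real, Real.norm_of_nonneg (tsum_nonneg hnn)]
    refine tsum_of_norm_bounded hs'.hasSum fun n ↦ ?_
    rcases eq_or_ne n 0 with rfl | hn
    · simp
    · have := LSeries.norm_term_le (f := (fun n : ℕ ↦ χ n) *
        fun n ↦ ((ArithmeticFunction.moebius n : ℤ) : ℂ)) (g := 1) (n := n) (σ : ℂ) (by
          rw [Pi.mul_apply, norm_mul, Pi.one_apply, norm_one]
          refine mul_le_one₀ (χ.norm_le_one _) (norm_nonneg _) ?_
          rw [Complex.norm_intCast]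
          exact_mod_cast ArithmeticFunction.abs_moebius_le_one)
      refine this.trans (le_of_eq ?_)
      rw [hterm, Complex.norm_real, Real.norm_of_nonneg (hnn n)]
  rw [LFunction_eq_LSeries χ hσ']
  calc (1 : ℝ) = _ := by rw [← norm_one (α := ℂ), ← h1, norm_mul]
    _ ≤ _ := mul_le_mul_of_nonneg_left h2 (norm_nonneg _)

/-- All three bounds follow from continuity at 1 of `F s = (s - 1) * ζ(s)`, which has `F 1 = 1`. -/
theorem riemannZeta_bounds_near_one : ∃ ε > 0, ∃ C > 0, ∀ s : ℂ, s ≠ 1 → ‖s - 1‖ < ε →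
    riemannZeta s ≠ 0 ∧ ‖riemannZeta s‖ ≤ 2 / ‖s - 1‖ ∧
      ‖logDeriv riemannZeta s + 1 / (s - 1)‖ ≤ C := by
  set F : ℂ → ℂ := DirichletCharacter.LFunctionTrivChar₁ 1 with hF
  have hFd : Differentiable ℂ F := DirichletCharacter.differentiable_LFunctionTrivChar₁ 1
  have hF1 : F 1 = 1 := by simp [hF]
  have hFs : ∀ s, s ≠ 1 → F s = (s - 1) * riemannZeta s := fun s hs ↦ by
    simp [hF, Function.update_of_ne hs]
  have hdF : ∀ s, s ≠ 1 → deriv F s = (s - 1) * deriv riemannZeta s + riemannZeta s :=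
    fun s hs ↦ by
      have := DirichletCharacter.deriv_LFunctionTrivChar₁_apply_of_ne_one 1 hs
      simpa only [DirichletCharacter.LFunctionTrivChar, DirichletCharacter.LFunction_modOne_eq]
        using this
  have hc : ContinuousAt (logDeriv F) 1 :=
    ((hFd.contDiff.continuous_deriv le_rfl).continuousAt).div hFd.continuous.continuousAt
      (by rw [hF1]; exact one_ne_zero)
  have e1 : ∀ᶠ s in nhds (1 : ℂ), F s ≠ 0 :=
    hFd.continuous.continuousAt.eventually_ne (by rw [hF1]; exact one_ne_zero)
  have e2 : ∀ᶠ s in nhds (1 : ℂ), ‖F s‖ < 2 :=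
    hFd.continuous.norm.continuousAt.eventually_lt continuousAt_const (by rw [hF1]; simp)
  have e3 : ∀ᶠ s in nhds (1 : ℂ), ‖logDeriv F s‖ < ‖logDeriv F 1‖ + 1 :=
    hc.norm.eventually_lt continuousAt_const (by simp)
  obtain ⟨ε, hε, h⟩ := Metric.eventually_nhds_iff.mp (e1.and (e2.and e3))
  refine ⟨ε, hε, ‖logDeriv F 1‖ + 1, by positivity, fun s hs hsε ↦ ?_⟩
  obtain ⟨h1, h2, h3⟩ := h (y := s) (by rwa [dist_eq_norm])
  have hs1 : s - 1 ≠ 0 := sub_ne_zero_of_ne hs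
  rw [hFs s hs] at h1 h2
  have hz : riemannZeta s ≠ 0 := right_ne_zero_of_mul h1
  refine ⟨hz, ?_, ?_⟩
  · rw [le_div_iff₀ (norm_pos_iff.mpr hs1), mul_comm, ← norm_mul]
    exact h2.le
  · refine le_trans (le_of_eq ?_) h3.le
    rw [logDeriv_apply, logDeriv_apply, hFs s hs, hdF s hs]
    congr 1
    field_simp

/-! ### Positivity and Landau's theorem. -/

theorem LSeries.re_nonneg {f : ℕ → ℂ} {σ : ℝ} (hs : LSeriesSummable f σ)
    (hf : ∀ n, 0 ≤ (f n).re) : 0 ≤ (LSeries f σ).re := by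
  rw [LSeries, Complex.re_tsum hs]
  refine tsum_nonneg fun n ↦ ?_
  rcases eq_or_ne n 0 with rfl | hn
  · simp
  · rw [LSeries.term_of_ne_zero hn, show ((n : ℂ) ^ (σ : ℂ)) = (((n : ℝ) ^ σ : ℝ) : ℂ) by
      rw [Complex.ofReal_cpow (by positivity)]; simp, Complex.div_ofReal_re]
    exact div_nonneg (hf n) (by positivity)

namespace DirichletCharacter

open ArithmeticFunction in
theorem LSeries_twist_vonMangoldt_eq_neg_logDeriv {N : ℕ} [NeZero N] (χ : DirichletCharacter ℂ N)
    {s : ℂ} (hs : 1 < s.re) :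
    LSeries ((fun n : ℕ ↦ χ n) * fun n ↦ (vonMangoldt n : ℂ)) s = -logDeriv (LFunction χ) s := by
  rw [LSeries_twist_vonMangoldt_eq χ hs, logDeriv_apply, LFunction_eq_LSeries χ hs,
    deriv_LFunction_eq_deriv_LSeries χ hs, neg_div]

open ArithmeticFunction in
theorem re_logDeriv_zeta_add_le {N : ℕ} [NeZero N] (χ : DirichletCharacter ℂ N)
    {σ : ℝ} (hσ : 1 < σ) :
    (logDeriv riemannZeta σ).re + (logDeriv (LFunction χ) σ).re ≤ 0 := by
  have hs : 1 < (σ : ℂ).re := by simpa using hσ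
  set V : ℕ → ℂ := fun n ↦ (vonMangoldt n : ℂ) with hV
  have hV0 : LSeriesSummable V σ := LSeriesSummable_vonMangoldt hs
  have hVχ := LSeriesSummable_twist_vonMangoldt χ hs
  have h := LSeries.re_nonneg (hV0.add hVχ) fun n ↦ by
    have h1 : -1 ≤ (χ n).re :=
      neg_le_of_abs_le ((Complex.abs_re_le_norm _).trans (χ.norm_le_one _))
    have h2 : 0 ≤ vonMangoldt n := vonMangoldt_nonneg
    simp only [Pi.add_apply, Pi.mul_apply, Complex.add_re, hV, Complex.re_mul_ofReal,
      Complex.ofReal_re]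
    nlinarith
  rw [LSeries_add hV0 hVχ, LSeries_twist_vonMangoldt_eq_neg_logDeriv χ hs,
    LSeries_vonMangoldt_eq_deriv_riemannZeta_div hs, neg_div, ← logDeriv_apply, Complex.add_re,
    Complex.neg_re, Complex.neg_re] at h
  linarith

/-- At a unit this is `‖1 + χ a + conj (χ' a)‖ ^ 2` with the conjugation adjusted, namely `‖1 + χ a
+ χ' a‖ ^ 2`; at a non-unit it is 3. -/
theorem re_three_add_nonneg {N : ℕ} (χ χ' : DirichletCharacter ℂ N) (a : ZMod N) :
    0 ≤ 3 + 2 * (χ a).re + 2 * (χ' a).re + 2 * ((χ * χ'⁻¹) a).re := by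
  by_cases ha : IsUnit a
  · have h1 : ‖χ a‖ = 1 := χ.unit_norm_eq_one ha.unit
    have h2 : ‖χ' a‖ = 1 := χ'.unit_norm_eq_one ha.unit
    have h3 : χ'⁻¹ a = (starRingEnd ℂ) (χ' a) := by
      rw [MulChar.inv_apply_eq_inv', Complex.inv_def, Complex.normSq_eq_norm_sq, h2]; simp
    rw [MulChar.mul_apply, h3, Complex.mul_re, Complex.conj_re, Complex.conj_im]
    rw [← sq_eq_sq₀ (norm_nonneg _) zero_le_one, ← Complex.normSq_eq_norm_sq,
      Complex.normSq_apply] at h1 h2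
    nlinarith [sq_nonneg (1 + (χ a).re + (χ' a).re), sq_nonneg ((χ a).im + (χ' a).im)]
  · simp [MulChar.map_nonunit _ ha]

open ArithmeticFunction in
theorem re_logDeriv_zeta_add_add_le {N : ℕ} [NeZero N] (χ χ' : DirichletCharacter ℂ N)
    {σ : ℝ} (hσ : 1 < σ) :
    3 * (logDeriv riemannZeta σ).re + 2 * (logDeriv (LFunction χ) σ).re +
      2 * (logDeriv (LFunction χ') σ).re + 2 * (logDeriv (LFunction (χ * χ'⁻¹)) σ).re ≤ 0 := by
  have hs : 1 < (σ : ℂ).re := by simpa using hσ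
  set V : ℕ → ℂ := fun n ↦ (vonMangoldt n : ℂ) with hV
  have h0 : LSeriesSummable ((3 : ℂ) • V) σ := (LSeriesSummable_vonMangoldt hs).smul 3
  have h1 := (LSeriesSummable_twist_vonMangoldt χ hs).smul 2
  have h2 := (LSeriesSummable_twist_vonMangoldt χ' hs).smul 2
  have h3 := (LSeriesSummable_twist_vonMangoldt (χ * χ'⁻¹) hs).smul 2
  have h := LSeries.re_nonneg (((h0.add h1).add h2).add h3) fun n ↦ by
    have h1 := mul_nonneg (re_three_add_nonneg χ χ' n) (vonMangoldt_nonneg (n := n))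
    simp only [Pi.add_apply, Pi.mul_apply, Pi.smul_apply, smul_eq_mul, Complex.add_re, hV,
      ← mul_assoc, Complex.mul_re, Complex.re_ofNat, Complex.im_ofNat, zero_mul, sub_zero]
    refine h1.trans (le_of_eq ?_)
    norm_num
    ring
  rw [LSeries_add ((h0.add h1).add h2) h3, LSeries_add (h0.add h1) h2, LSeries_add h0 h1,
    LSeries_smul, LSeries_smul, LSeries_smul, LSeries_smul,
    LSeries_twist_vonMangoldt_eq_neg_logDeriv χ hs,
    LSeries_twist_vonMangoldt_eq_neg_logDeriv χ' hs,
    LSeries_twist_vonMangoldt_eq_neg_logDeriv _ hs,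
    LSeries_vonMangoldt_eq_deriv_riemannZeta_div hs, neg_div, ← logDeriv_apply] at h
  simp only [Complex.add_re, Complex.mul_re, Complex.re_ofNat, Complex.im_ofNat, zero_mul, sub_zero, Complex.neg_re] at h
  linarith

/-- The data to which the lower bounds for the logarithmic derivative at the origin apply, for the
translate of an `L`-function by `σ`. -/
theorem translate_LFunction_spec {N : ℕ} [NeZero N] {χ : DirichletCharacter ℂ N} (hχ : χ ≠ 1)
    (hN : 20 ≤ N) {σ : ℝ} (hσ : 1 + 1 / (N : ℝ) ≤ σ) (hσ2 : σ ≤ 2)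
    (hζ : ‖riemannZeta σ‖ ≤ 2 / (σ - 1)) :
    Differentiable ℂ (fun z ↦ LFunction χ (σ + z)) ∧ LFunction χ (σ + 0) ≠ 0 ∧
    (∀ z ∈ Metric.closedBall (0 : ℂ) (1 / 2),
      ‖LFunction χ (σ + z)‖ ≤ ‖LFunction χ (σ + 0)‖ * Real.exp (3 * Real.log N)) ∧
    (∀ ρ : ℂ, LFunction χ (σ + ρ) = 0 → ρ.re ≤ 0) ∧
    logDeriv (fun z ↦ LFunction χ (σ + z)) 0 = logDeriv (LFunction χ) σ := by
  have hN' : (20 : ℝ) ≤ N := by exact_mod_cast hN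
  have hN0 : 0 < 1 / (N : ℝ) := by positivity
  have hσ1 : 1 < σ := by linarith
  have hd := differentiable_LFunction hχ
  refine ⟨hd.comp (differentiable_id.const_add _), ?_, fun z hz ↦ ?_, fun ρ hρ ↦ ?_, ?_⟩
  · exact LFunction_ne_zero_of_one_le_re χ (.inl hχ) (by simpa using hσ1.le)
  -- On the disc `‖L‖ ≤ 10 * N`, while `σ - 1 ≥ 1 / N` gives `‖L(σ, χ)‖ ≥ 1 / (2 * N)`. The ratio is
  -- at most `20 * N ^ 2 ≤ N ^ 3`.
  · have hlow := one_le_norm_LFunction_mul χ hσ1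
    have hz' : ‖z‖ ≤ 1 / 2 := mem_closedBall_zero_iff.mp hz
    have hre : 1 / 2 ≤ ((σ : ℂ) + z).re := by
      have := neg_le_of_abs_le ((Complex.abs_re_le_norm z).trans hz')
      simp only [Complex.add_re, Complex.ofReal_re]
      linarith
    have hnorm : ‖(σ : ℂ) + z‖ ≤ 5 / 2 := by
      refine (norm_add_le _ _).trans ?_
      rw [Complex.norm_real, Real.norm_of_nonneg (by linarith)]
      linarith
    have h1 : ‖LFunction χ (σ + z)‖ ≤ 10 * N := by
      refine (norm_LFunction_le hχ (by linarith)).trans ?_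
      rw [div_le_iff₀ (by linarith)]
      nlinarith
    have h2 : 1 / (N : ℝ) ≤ 2 * ‖LFunction χ σ‖ := by
      have h3 := hlow.trans (mul_le_mul_of_nonneg_left hζ (norm_nonneg _))
      rw [mul_div_assoc', le_div_iff₀ (by linarith)] at h3
      linarith
    rw [add_zero, mul_comm 3, Real.exp_mul, Real.exp_log (by positivity)]
    norm_cast
    rw [div_le_iff₀ (by positivity)] at h2
    push_cast
    calc _ ≤ 10 * (N : ℝ) * 1 := by linarith
      _ ≤ 10 * N * (2 * ‖LFunction χ σ‖ * N) := by gcongr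
      _ = ‖LFunction χ σ‖ * (20 * N ^ 2) := by ring
      _ ≤ _ := by gcongr; nlinarith [sq_nonneg (N : ℝ)]
  · by_contra! h
    exact LFunction_ne_zero_of_one_le_re χ (.inl hχ)
      (by simp only [Complex.add_re, Complex.ofReal_re]; linarith) hρ
  · rw [logDeriv_apply, logDeriv_apply, deriv_comp_const_add, add_zero]

theorem re_neg_one_div_ofReal_sub (β σ : ℝ) :
    (-(1 / ((β : ℂ) - σ))).re = 1 / (σ - β) := by
  rw [← Complex.ofReal_sub, ← Complex.ofReal_one, ← Complex.ofReal_div, ← Complex.ofReal_neg,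
    Complex.ofReal_re, ← neg_sub σ β, div_neg, neg_neg]

section

variable {N : ℕ} [NeZero N] {χ : DirichletCharacter ℂ N} {σ : ℝ}

theorem log_error_le (hN : 20 ≤ N) :
    12 * (3 * Real.log N + 1) / (1 / 2) ≤ 96 * Real.log N := by
  have h1 : 1 ≤ Real.log N := by
    rw [Real.le_log_iff_exp_le (by exact_mod_cast NeZero.pos N)]
    have : (20 : ℝ) ≤ N := by exact_mod_cast hN
    linarith [Real.exp_one_lt_d9]
  rw [div_le_iff₀ (by norm_num)]
  linarith

theorem neg_log_le_re_logDeriv_LFunction (hχ : χ ≠ 1) (hN : 20 ≤ N)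
    (hσ : 1 + 1 / (N : ℝ) ≤ σ) (hσ2 : σ ≤ 2) (hζ : ‖riemannZeta σ‖ ≤ 2 / (σ - 1)) :
    -(96 * Real.log N) ≤ (logDeriv (LFunction χ) σ).re := by
  obtain ⟨h1, h2, h3, h4, h5⟩ := translate_LFunction_spec hχ hN hσ hσ2 hζ
  have := neg_le_re_logDeriv_zero (by norm_num) h1 h2 h3 h4
  rw [h5] at this
  linarith [log_error_le hN]

theorem inv_sub_log_le_re_logDeriv_LFunction (hχ : χ ≠ 1) (hN : 20 ≤ N)
    (hσ : 1 + 1 / (N : ℝ) ≤ σ) (hσ2 : σ ≤ 2) (hζ : ‖riemannZeta σ‖ ≤ 2 / (σ - 1))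
    {β : ℝ} (hβ : LFunction χ β = 0) (hβσ : |β - σ| ≤ 1 / 6) :
    1 / (σ - β) - 96 * Real.log N ≤ (logDeriv (LFunction χ) σ).re := by
  obtain ⟨h1, h2, h3, h4, h5⟩ := translate_LFunction_spec hχ hN hσ hσ2 hζ
  have := inv_sub_le_re_logDeriv_zero (ρ := (β : ℂ) - σ) (by norm_num) h1 h2 h3 h4
    (by simpa using hβ)
    (by rw [← Complex.ofReal_sub, Complex.norm_real, Real.norm_eq_abs]; linarith)
  rw [h5, re_neg_one_div_ofReal_sub] at this
  linarith [log_error_le hN]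

theorem inv_add_inv_sub_log_le_re_logDeriv_LFunction (hχ : χ ≠ 1) (hN : 20 ≤ N)
    (hσ : 1 + 1 / (N : ℝ) ≤ σ) (hσ2 : σ ≤ 2) (hζ : ‖riemannZeta σ‖ ≤ 2 / (σ - 1))
    {β β' : ℝ} (hβ : LFunction χ β = 0) (hβσ : |β - σ| ≤ 1 / 6)
    (hβ' : LFunction χ β' = 0) (hβσ' : |β' - σ| ≤ 1 / 6) (hne : β' ≠ β) :
    1 / (σ - β) + 1 / (σ - β') - 96 * Real.log N ≤ (logDeriv (LFunction χ) σ).re := by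
  obtain ⟨h1, h2, h3, h4, h5⟩ := translate_LFunction_spec hχ hN hσ hσ2 hζ
  have := inv_add_inv_sub_le_re_logDeriv_zero (ρ := (β : ℂ) - σ) (ρ' := (β' : ℂ) - σ)
    (by norm_num) h1 h2 h3 h4 (by simpa using hβ)
    (by rw [← Complex.ofReal_sub, Complex.norm_real, Real.norm_eq_abs]; linarith)
    (by simpa using hβ')
    (by rw [← Complex.ofReal_sub, Complex.norm_real, Real.norm_eq_abs]; linarith)
    (by simpa using hne)
  rw [h5, re_neg_one_div_ofReal_sub, re_neg_one_div_ofReal_sub] at this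
  linarith [log_error_le hN]

end

/-- **Landau's theorem** on exceptional zeros: of two different real zeros of `L`-functions of
nontrivial characters with the same modulus `N`, the smaller one is not within `c / log N`
of `1`. -/
theorem exists_le_one_sub_div_log_of_lt : ∃ c > 0, ∀ᶠ N : ℕ in Filter.atTop, ∀ [NeZero N],
    ∀ χ χ' : DirichletCharacter ℂ N, χ ≠ 1 → χ' ≠ 1 → ∀ β β' : ℝ, β < β' → β' ≤ 1 →
      LFunction χ β = 0 → LFunction χ' β' = 0 → β ≤ 1 - c / Real.log N := by
  obtain ⟨ε, hε, C, hC, hζ⟩ := riemannZeta_bounds_near_one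
  -- `576 = 6 * 96`: in the main inequality three L-terms enter with weight 2, each with error `96 *
  -- log N`, and zeta with weight 3 and error `C`.
  set K : ℝ := 3 * C + 576 with hK
  have hK0 : 576 < K := by linarith
  have hlog : Filter.Tendsto (fun N : ℕ ↦ Real.log N) Filter.atTop Filter.atTop :=
    Real.tendsto_log_atTop.comp tendsto_natCast_atTop_atTop
  have hlit : ∀ᶠ N : ℕ in Filter.atTop, 8 * K * Real.log N ≤ N := by
    have h1 := (Real.isLittleO_log_id_atTop.comp_tendsto
      (tendsto_natCast_atTop_atTop (R := ℝ))).bound (c := 1 / (8 * K)) (by positivity)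
    filter_upwards [h1] with N h
    simp only [Function.comp_apply, id, Real.norm_eq_abs, Nat.abs_cast] at h
    have h2 := (le_abs_self _).trans h
    rw [div_mul_eq_mul_div, one_mul, le_div_iff₀ (by positivity)] at h2
    linarith
  refine ⟨1 / (56 * K), by positivity, ?_⟩
  filter_upwards [Filter.eventually_ge_atTop 20, hlit,
    hlog.eventually_gt_atTop (1 / (8 * K * ε)), hlog.eventually_ge_atTop 1] with N hN hN1 hN2 hN3
  intro _ χ χ' hχ hχ' β β' hlt hβ'1 hβ hβ'
  by_contra! hcon
  set ℓ := Real.log N with hℓ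
  -- The test point is `σ = 1 + η`. If `1 - β < η / 7` then `σ - β < 8 * η / 7`, so each zero
  -- contributes more than `7 / (8 * η)`.
  set η : ℝ := 1 / (8 * K * ℓ) with hη
  have hη0 : 0 < η := by positivity
  have hδ : 1 - β < η / 7 := by
    have : 1 / (56 * K) / ℓ = η / 7 := by rw [hη]; field_simp; norm_num
    linarith
  have hηs : η ≤ 1 / 20 := by
    rw [hη]; apply one_div_le_one_div_of_le (by norm_num); nlinarith
  have hηε : η < ε := by
    rw [hη, div_lt_iff₀ (by positivity)]
    rw [div_lt_iff₀ (by positivity)] at hN2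
    linarith
  have hσ : 1 + 1 / (N : ℝ) ≤ 1 + η := by
    have := one_div_le_one_div_of_le (by positivity) hN1
    linarith
  have hn : ‖((1 + η : ℝ) : ℂ) - 1‖ = η := by
    rw [← Complex.ofReal_one, ← Complex.ofReal_sub, Complex.norm_real, add_sub_cancel_left,
      Real.norm_of_nonneg hη0.le]
  obtain ⟨-, hz1, hz2⟩ := hζ ((1 + η : ℝ) : ℂ)
    (by rw [← sub_ne_zero, ← norm_pos_iff, hn]; exact hη0) (by rw [hn]; exact hηε)
  rw [hn] at hz1
  have hz1' : ‖riemannZeta ((1 + η : ℝ) : ℂ)‖ ≤ 2 / (1 + η - 1) := by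
    rwa [add_sub_cancel_left]
  have hz3 : -(1 / η) - C ≤ (logDeriv riemannZeta ((1 + η : ℝ) : ℂ)).re := by
    have h1 := neg_le_of_abs_le ((Complex.abs_re_le_norm _).trans hz2)
    rw [Complex.add_re, ← Complex.ofReal_one, ← Complex.ofReal_sub, ← Complex.ofReal_div,
      Complex.ofReal_re, add_sub_cancel_left] at h1
    linarith
  have hab : |β - (1 + η)| ≤ 1 / 6 := by rw [abs_le]; constructor <;> linarith
  have hab' : |β' - (1 + η)| ≤ 1 / 6 := by rw [abs_le]; constructor <;> linarith
  have hinv : 1 / (1 + η - β) ≤ 1 / (1 + η - β') :=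
    one_div_le_one_div_of_le (by linarith) (by linarith)
  have hinv' : 7 / 8 * (1 / η) < 1 / (1 + η - β) := by
    rw [← div_eq_mul_one_div, div_div, div_lt_div_iff₀ (by positivity) (by linarith)]
    linarith
  have hηK : 1 / η = 8 * (K * ℓ) := by rw [hη]; field_simp
  have hKℓ : K * ℓ = 3 * C * ℓ + 576 * ℓ := by rw [hK]; ring
  have hCℓ : C ≤ C * ℓ := le_mul_of_one_le_right hC.le hN3
  -- For equal characters, two zeros beat one pole: `2 * 7 / 8 > 1`. For distinct ones `χ * χ'⁻¹` is
  -- nontrivial and has no pole, and `4 * 7 / 8 > 3`. The surplus over `1 / η = 8 * K * ℓ` absorbs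
  -- the errors.
  rcases eq_or_ne χ χ' with rfl | hne
  · have h1 := inv_add_inv_sub_log_le_re_logDeriv_LFunction hχ hN hσ (by linarith) hz1' hβ hab
      hβ' hab' hlt.ne'
    have h2 := re_logDeriv_zeta_add_le χ (σ := 1 + η) (by linarith)
    linarith
  · have h1 := inv_sub_log_le_re_logDeriv_LFunction hχ hN hσ (by linarith) hz1' hβ hab
    have h1' := inv_sub_log_le_re_logDeriv_LFunction hχ' hN hσ (by linarith) hz1' hβ' hab'
    have h1'' := neg_log_le_re_logDeriv_LFunction (χ := χ * χ'⁻¹)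
      (by rwa [ne_eq, mul_inv_eq_one]) hN hσ (by linarith) hz1'
    have h2 := re_logDeriv_zeta_add_add_le χ χ' (σ := 1 + η) (by linarith)
    linarith

end DirichletCharacter

/-! ### Primorials, zeros from non-dutiful moduli, and the conclusion. -/

theorem primeProduct_natCast (n : ℕ) : primeProduct n = primorial n := by
  rw [primeProduct, primorial, Nat.floor_natCast]
  refine Finset.prod_congr (Finset.ext fun p ↦ ?_) fun _ _ ↦ rfl
  simp only [Finset.mem_filter, Finset.mem_Icc, Finset.mem_range, Nat.lt_succ_iff]
  exact ⟨fun h ↦ ⟨h.1.2, h.2⟩, fun h ↦ ⟨⟨h.2.one_le, h.1⟩, h.2⟩⟩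

theorem log_primorial_mono {m n : ℕ} (h : m ≤ n) :
    Real.log (primorial m) ≤ Real.log (primorial n) :=
  Real.log_le_log (by exact_mod_cast primorial_pos m) (by exact_mod_cast primorial_mono h)

theorem log_primorial_succ_le {n : ℕ} (hn : 2 < n) :
    Real.log (primorial (n + 1)) ≤ 2 * Real.log (primorial n) := by
  have h1 : primorial (n + 1) ≤ primorial n ^ 2 := by
    have h2 := primorial_add_le (m := n) (n := 1) (by omega)
    rw [Nat.choose_succ_self_right] at h2
    rw [sq]
    exact h2.trans (Nat.mul_le_mul_left _ (lt_primorial_self hn))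
  have h3 : ((primorial (n + 1) : ℕ) : ℝ) ≤ (primorial n : ℝ) ^ 2 := by exact_mod_cast h1
  have h4 := Real.log_le_log (by exact_mod_cast primorial_pos _) h3
  rwa [Real.log_pow, Nat.cast_ofNat] at h4

theorem tendsto_log_primorial :
    Filter.Tendsto (fun n : ℕ ↦ Real.log (primorial n)) Filter.atTop Filter.atTop := by
  refine Filter.tendsto_atTop_mono' _ ?_ (Real.tendsto_log_atTop.comp tendsto_natCast_atTop_atTop)
  filter_upwards [Filter.eventually_gt_atTop 2] with n hn
  exact Real.log_le_log (by positivity) (by exact_mod_cast (lt_primorial_self hn).le)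

theorem DirichletCharacter.LFunction_one_ne_zero_of_riemannZeta_ne_zero {N : ℕ} [NeZero N] {β : ℝ}
    (hβ : 0 < β) (hβ1 : β ≠ 1) (hζ : riemannZeta β ≠ 0) :
    LFunction (1 : DirichletCharacter ℂ N) β ≠ 0 := by
  have h := LFunctionTrivChar_eq_mul_riemannZeta (N := N) (s := (β : ℂ)) (by exact_mod_cast hβ1)
  rw [LFunctionTrivChar] at h
  rw [h]
  refine mul_ne_zero (Finset.prod_ne_zero_iff.mpr fun p hp ↦ ?_) hζ
  have hp1 := (Nat.prime_of_mem_primeFactors hp).one_lt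
  rw [sub_ne_zero]
  intro h1
  have h2 := congrArg norm h1
  rw [norm_one, Complex.norm_natCast_cpow_of_pos (by omega), Complex.neg_re,
    Complex.ofReal_re] at h2
  have := Real.rpow_lt_one_of_one_lt_of_neg (x := (p : ℝ)) (z := -β) (by exact_mod_cast hp1)
    (by linarith)
  linarith

open DirichletCharacter in
/-- If `Q` is not a dutiful modulus and is large, this is witnessed by a zero close to `1` of the
`L`-function of a nontrivial character. -/
theorem exists_zero_of_not_isDutiful (s : ℕ) : ∃ ℓ₀ : ℝ, ∀ (Q : ℕ) [NeZero Q],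
    ℓ₀ ≤ Real.log Q → ¬ IsDutiful s Q → ∃ (N : ℕ) (_ : NeZero N) (χ : DirichletCharacter ℂ N)
      (β : ℝ), Q ≤ N ∧ Real.log N ≤ 40 * s * (Real.log Q * Real.log (Real.log Q)) ∧ χ ≠ 1 ∧
        1 - 1 / Real.log Q ^ 2 < β ∧ β ≤ 1 ∧ LFunction χ β = 0 := by
  obtain ⟨ε, hε, _, _, hζ⟩ := riemannZeta_bounds_near_one
  refine ⟨1 + 1 / ε, fun Q _ hQ hbad ↦ ?_⟩
  suffices key : ∀ (k q : ℕ) [NeZero q], (k : ℝ) ≤ 20 * s * Real.log (Real.log Q) →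
      (q : ℝ) ≤ Real.log Q ^ (1 / 10 : ℝ) → ∀ (χ : DirichletCharacter ℂ ((q * Q) ^ k)),
      ∀ β ∈ Set.Icc (1 / 2 : ℝ) 1, (χ ≠ 1 ∨ β ≠ 1) → LFunction χ (β : ℂ) = 0 →
      1 - 1 / Real.log Q ^ 2 < β → ∃ (N : ℕ) (_ : NeZero N) (χ : DirichletCharacter ℂ N)
      (β : ℝ), Q ≤ N ∧ Real.log N ≤ 40 * s * (Real.log Q * Real.log (Real.log Q)) ∧ χ ≠ 1 ∧
        1 - 1 / Real.log Q ^ 2 < β ∧ β ≤ 1 ∧ LFunction χ β = 0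
  · simp only [IsDutiful, not_forall, not_le] at hbad
    obtain ⟨q, hq0, hq, χ, β, hβ, hχβ, hL, hlt⟩ := hbad
    have hlog : 0 ≤ Real.log (Real.log Q) :=
      Real.log_nonneg (by linarith [one_div_pos.mpr hε])
    exact key _ q (Nat.floor_le (by positivity)) hq χ β hβ hχβ hL hlt
  intro k q _ h1 hq χ β hβ hχβ hL hlt
  set ℓ := Real.log Q with hℓ
  have hε' : 0 < 1 / ε := by positivity
  have hℓ1 : 1 ≤ ℓ := by linarith
  have hχ : χ ≠ 1 := by
    intro h
    have hβ1 : β ≠ 1 := hχβ.resolve_left (not_not.mpr h)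
    rw [h] at hL
    refine LFunction_one_ne_zero_of_riemannZeta_ne_zero (by linarith [hβ.1]) hβ1 ?_ hL
    refine (hζ β (by exact_mod_cast hβ1) ?_).1
    rw [← Complex.ofReal_one, ← Complex.ofReal_sub, Complex.norm_real, Real.norm_eq_abs,
      abs_sub_comm, abs_of_nonneg (by linarith [hβ.2])]
    have h3 : 1 / ℓ ^ 2 ≤ 1 / ℓ := one_div_le_one_div_of_le (by linarith) (by nlinarith)
    have h2 : 1 / ℓ < ε := by
      rw [div_lt_iff₀ (by linarith), ← div_lt_iff₀' hε]
      linarith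
    linarith
  refine ⟨(q * Q) ^ k, inferInstance, χ, β, ?_, ?_, hχ, hlt, hβ.2, hL⟩
  -- With exponent 0 the modulus is 1, which has only the trivial character.
  · have hk0 : k ≠ 0 := by
      rintro rfl
      exact hχ (DirichletCharacter.level_one' χ (pow_zero _))
    exact (Nat.le_mul_of_pos_left Q (NeZero.pos q)).trans (Nat.le_self_pow hk0 _)
  · have hℓℓ : 0 ≤ Real.log ℓ := Real.log_nonneg hℓ1
    have hqpos : (0 : ℝ) < q := by exact_mod_cast NeZero.pos q
    have h2 : Real.log q ≤ ℓ := by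
      have h3 := hq.trans (Real.rpow_le_rpow_of_exponent_le hℓ1 (by norm_num : (1 / 10 : ℝ) ≤ 1))
      rw [Real.rpow_one] at h3
      exact (Real.log_le_self hqpos.le).trans h3
    have hQ0 : (Q : ℝ) ≠ 0 := by exact_mod_cast NeZero.ne Q
    push_cast
    rw [Real.log_pow, Real.log_mul hqpos.ne' hQ0]
    calc _ ≤ 20 * s * Real.log ℓ * (ℓ + ℓ) := by
          refine mul_le_mul h1 (by linarith) ?_ (by positivity)
          exact add_nonneg (Real.log_natCast_nonneg q) (by linarith)
      _ = _ := by ring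

open DirichletCharacter in
theorem mainTheorem7 (s : ℕ) :
    ∀ Z : ℝ, ∃ z : ℝ, Z ≤ z ∧ IsDutiful s (primeProduct z) := by
  intro Z
  by_contra! hcon
  obtain ⟨c, hc, hL⟩ := exists_le_one_sub_div_log_of_lt
  obtain ⟨N₀, hL⟩ := Filter.eventually_atTop.mp hL
  obtain ⟨ℓ₀, hbad⟩ := exists_zero_of_not_isDutiful s
  set ℓ : ℕ → ℝ := fun n ↦ Real.log (primorial n) with hℓ
  -- `320 = 4 * 80`: the 4 comes from `ℓ (m + 1) ≤ 2 * ℓ m` squared, the 80 from the two moduli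
  -- together.
  have hlit : ∀ᶠ x : ℝ in Filter.atTop, 320 * s * Real.log x ≤ c * x := by
    have h1 := Real.isLittleO_log_id_atTop.bound (c := c / (320 * (s + 1))) (by positivity)
    filter_upwards [h1, Filter.eventually_ge_atTop 1] with x hx hx1
    rw [Real.norm_of_nonneg (Real.log_nonneg hx1), id, Real.norm_of_nonneg (by linarith),
      div_mul_eq_mul_div, le_div_iff₀ (by positivity)] at hx
    nlinarith [Real.log_nonneg hx1]
  obtain ⟨x₀, hlit⟩ := Filter.eventually_atTop.mp hlit
  have hlim : Filter.Tendsto ℓ Filter.atTop Filter.atTop := tendsto_log_primorial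
  obtain ⟨n₁, hn₁, hn₁N, hn₁2, hn₁ℓ⟩ := ((tendsto_natCast_atTop_atTop.eventually_ge_atTop Z).and
    ((Filter.eventually_ge_atTop N₀).and ((Filter.eventually_gt_atTop 2).and
    (hlim.eventually_ge_atTop (max (max ℓ₀ x₀) 1))))).exists
  have hmono : Monotone ℓ := fun m n h ↦ log_primorial_mono h
  have hwit : ∀ n, n₁ ≤ n → ∃ (N : ℕ) (_ : NeZero N) (χ : DirichletCharacter ℂ N) (β : ℝ),
      primorial n ≤ N ∧ Real.log N ≤ 40 * s * (ℓ n * Real.log (ℓ n)) ∧ χ ≠ 1 ∧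
        1 - 1 / ℓ n ^ 2 < β ∧ β ≤ 1 ∧ LFunction χ β = 0 := by
    intro n hn
    have h1 := hcon n (hn₁.trans (by exact_mod_cast hn))
    have h2 := hbad (primeProduct n) (by
      rw [primeProduct_natCast]
      exact (le_max_left _ _).trans ((le_max_left _ _).trans (hn₁ℓ.trans (hmono hn)))) h1
    rwa [primeProduct_natCast] at h2
  obtain ⟨N₁, _, χ₁, β₁, hN₁, hN₁log, hχ₁, hβ₁, hβ₁1, hL₁⟩ := hwit n₁ le_rfl
  have hβ₁lt : β₁ < 1 := lt_of_le_of_ne hβ₁1 fun h ↦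
    LFunction_apply_one_ne_zero hχ₁ (by simpa [h] using hL₁)
  have hex : ∃ n, n₁ < n ∧ 1 / ℓ n ^ 2 ≤ 1 - β₁ := by
    have h1 : Filter.Tendsto (fun n ↦ 1 / ℓ n ^ 2) Filter.atTop (nhds 0) := by
      simp only [one_div]
      exact ((Filter.tendsto_pow_atTop two_ne_zero).comp hlim).inv_tendsto_atTop
    exact ((Filter.eventually_gt_atTop n₁).and
      (h1.eventually_le_const (sub_pos.mpr hβ₁lt))).exists
  obtain ⟨m, hm, hm1, hm2, hm3⟩ : ∃ m, n₁ ≤ m ∧ 1 - β₁ < 1 / ℓ m ^ 2 ∧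
      1 / ℓ (m + 1) ^ 2 ≤ 1 - β₁ ∧ ℓ (m + 1) ≤ 2 * ℓ m := by
    classical
    obtain ⟨h1, h2⟩ := Nat.find_spec hex
    obtain ⟨m, hm⟩ : ∃ m, Nat.find hex = m + 1 := ⟨Nat.find hex - 1, by omega⟩
    rw [hm] at h1 h2
    have hnm : n₁ ≤ m := Nat.lt_succ_iff.mp h1
    refine ⟨m, hnm, ?_, h2, log_primorial_succ_le (by omega)⟩
    -- If `m = n₁`, the bound is the one that came with `β₁`; otherwise it is minimality of `m + 1`.
    rcases hnm.eq_or_lt with rfl | hlt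
    · linarith
    · by_contra! h
      exact Nat.find_min hex (m := m) (by omega) ⟨hlt, h⟩
  obtain ⟨N₂, _, χ₂, β₂, hN₂, hN₂log, hχ₂, hβ₂, hβ₂1, hL₂⟩ := hwit (m + 1) (by omega)
  have hℓm : 1 ≤ ℓ m := (le_max_right _ _).trans (hn₁ℓ.trans (hmono hm))
  have hℓm' : ℓ m ≤ ℓ (m + 1) := hmono (Nat.le_succ m)
  have hℓ₁ : 1 ≤ ℓ n₁ := (le_max_right _ _).trans hn₁ℓ
  have hℓ₁m : ℓ n₁ ≤ ℓ (m + 1) := hmono (by omega)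
  have hN₁lt : n₁ < N₁ := (lt_primorial_self hn₁2).trans_le hN₁
  have hNle : N₁ ≤ N₁ * N₂ := Nat.le_mul_of_pos_right _ (NeZero.pos N₂)
  have hkey := hL (N₁ * N₂) (by omega) (changeLevel (Nat.dvd_mul_right N₁ N₂) χ₁)
    (changeLevel (Nat.dvd_mul_left N₂ N₁) χ₂) (by rwa [ne_eq, changeLevel_eq_one_iff])
    (by rwa [ne_eq, changeLevel_eq_one_iff]) β₁ β₂ (by linarith) hβ₂1
    (by rw [LFunction_changeLevel _ _ (.inl hχ₁), hL₁, zero_mul])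
    (by rw [LFunction_changeLevel _ _ (.inl hχ₂), hL₂, zero_mul])
  have hlogN : Real.log ((N₁ * N₂ : ℕ) : ℝ) ≤ 80 * s * (ℓ (m + 1) * Real.log (ℓ (m + 1))) := by
    have h1 : ℓ n₁ * Real.log (ℓ n₁) ≤ ℓ (m + 1) * Real.log (ℓ (m + 1)) :=
      mul_le_mul hℓ₁m (Real.log_le_log (by linarith) hℓ₁m) (Real.log_nonneg hℓ₁) (by linarith)
    have h2 := mul_le_mul_of_nonneg_left h1 (by positivity : (0 : ℝ) ≤ 40 * s)
    rw [Nat.cast_mul, Real.log_mul (by exact_mod_cast NeZero.ne N₁)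
      (by exact_mod_cast NeZero.ne N₂)]
    linarith
  have hlogpos : 0 < Real.log ((N₁ * N₂ : ℕ) : ℝ) := Real.log_pos (by exact_mod_cast (by omega))
  have hlast := hlit (ℓ (m + 1)) ((le_max_right _ _).trans ((le_max_left _ _).trans
    (hn₁ℓ.trans hℓ₁m)))
  have h1 : c / Real.log ((N₁ * N₂ : ℕ) : ℝ) < 1 / ℓ m ^ 2 := by linarith
  rw [div_lt_div_iff₀ hlogpos (by positivity), one_mul] at h1
  have h2 : c * ℓ (m + 1) ^ 2 ≤ 4 * (c * ℓ m ^ 2) := by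
    have : ℓ (m + 1) ^ 2 ≤ (2 * ℓ m) ^ 2 := by gcongr
    nlinarith
  have h3 := mul_le_mul_of_nonneg_right hlast (by linarith : 0 ≤ ℓ (m + 1))
  linarith
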